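/- Let $X$ and $Y$ be Banach spaces over the same scalar field $\mathbb{K}\in\{\mathbb{R},\mathbb{C}\}$, and let $k\in\mathbb{Z}$. "Operator" means bounded linear map, and "isomorphism" means bijective operator between Banach spaces. An operator $T$ on $X$ is a Fredholm operator if $\ker T$ and $X/\operatorname{ran}T$ are finite-dimensional; its index is $\dim\ker T-\dim X/\operatorname{ran}T$. Let $\Phi_k(X)$ be the set of Fredholm operators of index $k$ on $X$, and set $\mathbb{I}_\Phi(X)=\{j\in\mathbb{Z}:\Phi_j(X)\neq\emptyset\}$. Define $\operatorname{eae}(X,Y)$ to be the least positive integer in $\mathbb{I}_\Phi(X)\cap\mathbb{I}_\Phi(Y)$ if there is one, and $\operatorname{eae}(X,Y)=0$ otherwise. Operators $U$ on $X$ and $V$ on $Y$ are equivalent after extension (EAE) if there are Banach spaces $X_0,Y_0$ and isomorphisms $E\colon Y\oplus Y_0\to X\oplus X_0$ and $F\colon X\oplus X_0\to Y\oplus Y_0$ such that $$\begin{bmatrix}U&0\\0&I_{X_0}\end{bmatrix}=E\begin{bmatrix}V&0\\0&I_{Y_0}\end{bmatrix}F .$$ They are Schur coupled (SC) if there are isomorphisms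 $A\colon X\to X$ and $D\colon Y\to Y$ and operators $B\colon Y\to X$ and $C\colon X\to Y$ such that $U=A-BD^{-1}C$ and $V=D-CA^{-1}B$. Let $\operatorname{EAE}_k(X,Y)$ and $\operatorname{SC}_k(X,Y)$ be the sets of pairs $(U,V)\in\Phi_k(X)\times\Phi_k(Y)$ that are EAE and SC, respectively. Then: (i) $\operatorname{EAE}_k(X,Y)\neq\emptyset$ if and only if $k\in\operatorname{eae}(X,Y)\mathbb{Z}$. (ii) If $k\in\operatorname{eae}(X,Y)\mathbb{Z}$, then $\operatorname{SC}_k(X,Y)=\operatorname{EAE}_k(X,Y)$ if and only if $\operatorname{SC}_k(X,Y)\neq\emptyset$. (iii) If $k\notin\operatorname{eae}(X,Y)\mathbb{Z}$, then $\Phi_k(X)=\emptyset$ or $\Phi_k(Y)=\emptyset$, and consequently $\operatorname{SC}_k(X,Y)=\operatorname{EAE}_k(X,Y)=\emptyset$. -/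

import Mathlib

namespace FredholmCoupling

universe u v

section Definitions

variable (𝕜 : Type*) [RCLike 𝕜]
variable (X : Type u) [NormedAddCommGroup X] [NormedSpace 𝕜 X]
variable (Y : Type v) [NormedAddCommGroup Y] [NormedSpace 𝕜 Y]

/-- `Phi 𝕜 X k` is the set of Fredholm operators of index `k` on `X`, where the index is
`dim ker T - dim (X / ran T)`. For Banach spaces, `isFredholm_iff` below shows that Mathlib's
`IsFredholm` says exactly that these two dimensions are finite. -/
def Phi (k : ℤ) : Set (X →L[𝕜] X) :=
  {T | T.IsFredholm ∧ T.toLinearMap.index = k}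

/-- The set of all `k : ℤ` such that there is a Fredholm operator of index `k` on `X`. -/
def indexSet : Set ℤ :=
  {k | (Phi 𝕜 X k).Nonempty}

variable {𝕜 X Y}

/-- `U` and `V` are equivalent after extension: `U ⊕ I = E (V ⊕ I) F` for some Banach spaces
`X₀`, `Y₀` and isomorphisms `E : Y ⊕ Y₀ → X ⊕ X₀`, `F : X ⊕ X₀ → Y ⊕ Y₀`.
The universe of `X₀` and `Y₀` contains (copies of) both `X` and `Y`. -/
def IsEAE (U : X →L[𝕜] X) (V : Y →L[𝕜] Y) : Prop :=
  ∃ (X₀ : Type (max u v)) (_ : NormedAddCommGroup X₀) (_ : NormedSpace 𝕜 X₀) (_ : CompleteSpace X₀)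
    (Y₀ : Type (max u v)) (_ : NormedAddCommGroup Y₀) (_ : NormedSpace 𝕜 Y₀) (_ : CompleteSpace Y₀)
    (E : (Y × Y₀) ≃L[𝕜] (X × X₀)) (F : (X × X₀) ≃L[𝕜] (Y × Y₀)),
    U.prodMap (ContinuousLinearMap.id 𝕜 X₀) =
      (E : (Y × Y₀) →L[𝕜] (X × X₀)) ∘L V.prodMap (ContinuousLinearMap.id 𝕜 Y₀) ∘L
        (F : (X × X₀) →L[𝕜] (Y × Y₀))

/-- `U` and `V` are Schur coupled: `U = A - B D⁻¹ C` and `V = D - C A⁻¹ B` for some isomorphisms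
`A`, `D` and operators `B`, `C`. -/
def IsSC (U : X →L[𝕜] X) (V : Y →L[𝕜] Y) : Prop :=
  ∃ (A : X ≃L[𝕜] X) (D : Y ≃L[𝕜] Y) (B : Y →L[𝕜] X) (C : X →L[𝕜] Y),
    U = (A : X →L[𝕜] X) - B ∘L (D.symm : Y →L[𝕜] Y) ∘L C ∧
    V = (D : Y →L[𝕜] Y) - C ∘L (A.symm : X →L[𝕜] X) ∘L B

variable (𝕜 X Y)

/-- The pairs of Fredholm operators of index `k` on `X` and `Y` that are equivalent after
extension. -/
def EAE (k : ℤ) : Set ((X →L[𝕜] X) × (Y →L[𝕜] Y)) :=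
  {p | p.1 ∈ Phi 𝕜 X k ∧ p.2 ∈ Phi 𝕜 Y k ∧ IsEAE p.1 p.2}

/-- The pairs of Fredholm operators of index `k` on `X` and `Y` that are Schur coupled. -/
def SC (k : ℤ) : Set ((X →L[𝕜] X) × (Y →L[𝕜] Y)) :=
  {p | p.1 ∈ Phi 𝕜 X k ∧ p.2 ∈ Phi 𝕜 Y k ∧ IsSC p.1 p.2}

open Classical in
/-- The least positive integer in `indexSet 𝕜 X ∩ indexSet 𝕜 Y`, or `0` if there is none. -/
noncomputable def eae : ℕ :=
  if h : ∃ n : ℕ, 0 < n ∧ (n : ℤ) ∈ indexSet 𝕜 X ∩ indexSet 𝕜 Y then Nat.find h else 0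

end Definitions

/-- An operator between Banach spaces is Fredholm if and only if its kernel and its cokernel are
finite-dimensional. -/
theorem isFredholm_iff {𝕜 : Type*} [RCLike 𝕜]
    {X : Type*} [NormedAddCommGroup X] [NormedSpace 𝕜 X] [CompleteSpace X]
    {Y : Type*} [NormedAddCommGroup Y] [NormedSpace 𝕜 Y] [CompleteSpace Y] (T : X →L[𝕜] Y) :
    T.IsFredholm ↔ FiniteDimensional 𝕜 T.ker ∧ FiniteDimensional 𝕜 (Y ⧸ T.range) := by
  refine ⟨fun h => ⟨h.finite_ker, h.finite_coker⟩, fun ⟨h₁, h₂⟩ => ?_⟩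
  have hk : T.ker.ClosedComplemented := Submodule.ClosedComplemented.of_finiteDimensional T.ker
  have hc : IsClosed (T.range : Set Y) := by
    obtain ⟨W, hW, hcomp⟩ := hk.exists_isClosed_isCompl
    have : CompleteSpace W := hW.completeSpace_coe
    obtain ⟨G, hG⟩ := T.range.exists_isCompl
    have hGfin : FiniteDimensional 𝕜 G :=
      Module.Finite.equiv (Submodule.quotientEquivOfIsCompl _ _ hG)
    have hr : (T ∘L W.subtypeL).range = T.range := by
      apply le_antisymm
      · rintro _ ⟨x, rfl⟩
        exact ⟨x, rfl⟩
      · rintro _ ⟨x, rfl⟩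
        obtain ⟨a, ha, b, hb, rfl⟩ := Submodule.mem_sup.1
          (hcomp.sup_eq_top ▸ Submodule.mem_top : x ∈ T.ker ⊔ W)
        have ha' : T a = 0 := ha
        exact ⟨⟨b, hb⟩, by simp [ha']⟩
    have hker : (T ∘L W.subtypeL).ker = ⊥ := by
      rw [eq_bot_iff]
      rintro ⟨x, hx⟩ h
      have : x ∈ T.ker ⊓ W := ⟨h, hx⟩
      rw [hcomp.inf_eq_bot] at this
      simpa using this
    have := (T ∘L W.subtypeL).closed_complemented_range_of_isCompl_of_ker_eq_bot G
      (hr ▸ hG) G.closed_of_finiteDimensional hker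
    rwa [hr] at this
  have : CompleteSpace T.range := hc.completeSpace_coe
  refine ⟨?_, hc, h₁, h₂, hk⟩
  refine T.toLinearMap.isStrictMap_iff_isOpenQuotientMap_rangeRestrict.2 ?_
  have hs : Function.Surjective T.rangeRestrict := T.toLinearMap.surjective_rangeRestrict
  exact ⟨hs, T.rangeRestrict.continuous, T.rangeRestrict.isOpenMap hs⟩

end FredholmCoupling

open FredholmCoupling

/-! Once the index is fixed, everything is governed by the nullity. Fredholm operators of equal
index and nullity on isomorphic Banach spaces are equivalent (`exists_equiv_comp_eq`). Since `X ⊕ Y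
≅ Y ⊕ X`, operators of index `k` on `X` and `Y` are EAE exactly when their nullities agree.
Finite-rank perturbations bring the nullity to `max k 0` on either space, so an EAE pair exists iff
`k` is an index on both. The common indices form a subgroup of `ℤ`, generated by `eae`.

Schur coupling forces equal nullities, hence EAE. Conversely, whether a pair of index `k` is SC
depends only on its nullities (`IsSC.of_finrank_ker_eq`). From one SC pair, rank-one perturbations
of `A` lower the nullity as far as the index allows, or raise it without bound if `k ≠ 0`, so every
common nullity occurs. For `k = 0`, SC pairs are built from projections. -/

namespace FredholmCoupling

/-! ### Finite-rank perturbations of Fredholm operators -/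

section FredholmOperators

open LinearMap.FiniteRangeSetoid

variable {𝕜 : Type*} [RCLike 𝕜]
variable {E : Type*} [NormedAddCommGroup E] [NormedSpace 𝕜 E]
variable {F : Type*} [NormedAddCommGroup F] [NormedSpace 𝕜 F]
variable {G : Type*} [NormedAddCommGroup G] [NormedSpace 𝕜 G]

lemma IsFredholm.comp {S : F →L[𝕜] G} {T : E →L[𝕜] F} (hS : S.IsFredholm) (hT : T.IsFredholm) :
    (S ∘L T).IsFredholm := by
  obtain ⟨s, hs⟩ := hS.exists_isQuasiInverse
  obtain ⟨t, ht⟩ := hT.exists_isQuasiInverse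
  exact .of_isQuasiInverse (v := t ∘L s) (ht.comp hs)

lemma IsFredholm.index_comp {S : F →L[𝕜] G} {T : E →L[𝕜] F} (hS : S.IsFredholm)
    (hT : T.IsFredholm) :
    (S ∘L T).toLinearMap.index = S.toLinearMap.index + T.toLinearMap.index := by
  have := hS.finite_ker
  have := hT.finite_ker
  have : FiniteDimensional 𝕜 (G ⧸ S.range) := hS.finite_coker
  have : FiniteDimensional 𝕜 (F ⧸ T.range) := hT.finite_coker
  exact LinearMap.index_comp _

lemma isFredholm_equiv (e : E ≃L[𝕜] F) : (e : E →L[𝕜] F).IsFredholm :=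
  .of_isQuasiInverse (v := (e.symm : F →L[𝕜] E)) e.toLinearEquiv.isQuasiInverse

lemma index_equiv (e : E ≃L[𝕜] F) : (e : E →L[𝕜] F).toLinearMap.index = 0 :=
  e.toLinearEquiv.index_eq_zero

lemma IsFredholm.of_equiv {S T : E →L[𝕜] F} (hT : T.IsFredholm)
    (h : S.toLinearMap ≈ T.toLinearMap) : S.IsFredholm := by
  obtain ⟨t, ht⟩ := hT.exists_isQuasiInverse
  exact .of_isQuasiInverse (v := t) (ht.congr (Setoid.refl _) h)

/-- The index of a Fredholm operator is invariant under perturbations of finite rank: both operators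
have the same restriction to a subspace of finite codimension. -/
lemma IsFredholm.index_eq_of_equiv {S T : E →L[𝕜] F} (hT : T.IsFredholm)
    (h : S.toLinearMap ≈ T.toLinearMap) : S.toLinearMap.index = T.toLinearMap.index := by
  have hS := IsFredholm.of_equiv hT h
  have := hS.finite_ker
  have := hT.finite_ker
  have : FiniteDimensional 𝕜 (F ⧸ S.range) := hS.finite_coker
  have : FiniteDimensional 𝕜 (F ⧸ T.range) := hT.finite_coker
  rw [equiv_iff_isNoetherian_quotient_eqLocus] at h
  set L := LinearMap.eqLocus S.toLinearMap T.toLinearMap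
  have : FiniteDimensional 𝕜 L.subtype.ker := by rw [Submodule.ker_subtype]; infer_instance
  have : FiniteDimensional 𝕜 (E ⧸ L.subtype.range) := by
    rw [Submodule.range_subtype]; infer_instance
  have hST : S.toLinearMap ∘ₗ L.subtype = T.toLinearMap ∘ₗ L.subtype := by
    ext x
    exact x.2
  have h₁ := LinearMap.index_comp (f := L.subtype) S.toLinearMap
  have h₂ := LinearMap.index_comp (f := L.subtype) T.toLinearMap
  rw [hST] at h₁
  linarith

lemma equiv_of_sub_hasFiniteRange {S T : E →L[𝕜] F} (h : (S - T).toLinearMap.HasFiniteRange) :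
    S.toLinearMap ≈ T.toLinearMap :=
  equiv_iff_hasFiniteRange.2 h

lemma hasFiniteRange_smulRight (f : E →L[𝕜] 𝕜) (c : F) :
    (f.smulRight c).toLinearMap.HasFiniteRange := by
  have : (f.smulRight c).toLinearMap = LinearMap.toSpanSingleton 𝕜 F c ∘ₗ f.toLinearMap := by
    ext; simp
  rw [this]
  exact LinearMap.HasFiniteRange.comp_right .of_finite_dom _

lemma add_smulRight_equiv (T : E →L[𝕜] F) (f : E →L[𝕜] 𝕜) (c : F) :
    (T + f.smulRight c).toLinearMap ≈ T.toLinearMap := by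
  apply equiv_of_sub_hasFiniteRange
  rw [add_sub_cancel_left]
  exact hasFiniteRange_smulRight f c

lemma finrank_coker_eq {S : E →L[𝕜] E} {T : F →L[𝕜] F}
    (hi : S.toLinearMap.index = T.toLinearMap.index)
    (hk : Module.finrank 𝕜 S.ker = Module.finrank 𝕜 T.ker) :
    Module.finrank 𝕜 (E ⧸ S.range) = Module.finrank 𝕜 (F ⧸ T.range) := by
  have h₁ : _ = _ := LinearMap.index_eq_finrank_sub (f := S.toLinearMap)
  have h₂ : _ = _ := LinearMap.index_eq_finrank_sub (f := T.toLinearMap)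
  lia

lemma finrank_inf_ker {M : Submodule 𝕜 E} [FiniteDimensional 𝕜 M] (f : E →L[𝕜] 𝕜) {x : E}
    (hx : x ∈ M) (hfx : f x ≠ 0) :
    Module.finrank 𝕜 M = Module.finrank 𝕜 ↥(M ⊓ f.ker) + 1 := by
  let g : M →ₗ[𝕜] 𝕜 := f.toLinearMap ∘ₗ M.subtype
  have hg : Function.Surjective g := LinearMap.surjective fun h => hfx congr($h ⟨x, hx⟩)
  have h := g.finrank_range_add_finrank_ker
  rw [LinearMap.range_eq_top.2 hg, finrank_top, Module.finrank_self] at h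
  have e : g.ker ≃ₗ[𝕜] ↥(M ⊓ f.ker) :=
    (Submodule.equivMapOfInjective M.subtype M.subtype_injective g.ker).trans
      (LinearEquiv.ofEq _ _ (by
        rw [LinearMap.ker_comp, Submodule.map_comap_subtype]))
  rw [← e.finrank_eq]
  lia

/-- Adding a rank-one operator that maps a vector of the kernel outside of the range decreases the
dimension of the kernel by one. -/
lemma ker_add_smulRight (T : E →L[𝕜] F) (f : E →L[𝕜] 𝕜) {c : F} (hc : c ∉ T.range) :
    (T + f.smulRight c).ker = T.ker ⊓ f.ker := by
  ext x
  simp only [LinearMap.mem_ker, Submodule.mem_inf, ContinuousLinearMap.coe_coe,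
    add_apply, ContinuousLinearMap.smulRight_apply]
  refine ⟨fun h => ?_, fun ⟨h₁, h₂⟩ => by simp [h₁, h₂]⟩
  have hf : f x = 0 := by
    by_contra hf
    refine hc ⟨-((f x)⁻¹ • x), ?_⟩
    have : T x = -(f x • c) := eq_neg_of_add_eq_zero_left h
    simp [this, smul_smul, hf]
  simpa [hf] using h

/-- Take `f` nonzero at some kernel vector and `c` outside the range. The scalar `t` stays free so
that Schur coupling can later avoid the value that makes the perturbed `A` singular. -/
lemma exists_add_smulRight_ker {T : E →L[𝕜] F} (hT : T.IsFredholm)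
    (hk : 0 < Module.finrank 𝕜 T.ker) (hr : T.range ≠ ⊤) :
    ∃ (f : E →L[𝕜] 𝕜) (c : F), ∀ t : 𝕜, t ≠ 0 →
      Module.finrank 𝕜 T.ker = Module.finrank 𝕜 (T + f.smulRight (t • c)).ker + 1 := by
  have := hT.finite_ker
  obtain ⟨x, hx⟩ := (Module.finrank_pos_iff_exists_ne_zero (R := 𝕜)).1 hk
  obtain ⟨f, hf⟩ := SeparatingDual.exists_ne_zero (R := 𝕜) (x := (x : E)) (by simpa using hx)
  obtain ⟨c, hc⟩ := SetLike.exists_not_mem_of_ne_top _ hr rfl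
  refine ⟨f, c, fun t ht => ?_⟩
  rw [ker_add_smulRight T f (by rwa [Submodule.smul_mem_iff _ ht])]
  exact finrank_inf_ker f x.2 hf

/-- If `T x ≠ 0` and `g (T x) = 1`, then the kernel of `T - g (T ·) T x` is spanned by `x` and the
kernel of `T`. -/
lemma finrank_ker_sub_smulRight {T : E →L[𝕜] F} (hT : T.IsFredholm) {x : E} {g : F →L[𝕜] 𝕜}
    (hg : g (T x) = 1) :
    Module.finrank 𝕜 (T + (g ∘L T).smulRight (-T x)).ker = Module.finrank 𝕜 T.ker + 1 := by
  have := (IsFredholm.of_equiv hT (add_smulRight_equiv T (g ∘L T) (-T x))).finite_ker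
  rw [finrank_inf_ker (g ∘L T) (x := x) (by simp [hg]) (by simp [hg])]
  have : (T + (g ∘L T).smulRight (-T x)).ker ⊓ (g ∘L T).ker = T.ker := by
    ext y
    simp only [LinearMap.mem_ker, Submodule.mem_inf, ContinuousLinearMap.coe_coe,
      add_apply, ContinuousLinearMap.smulRight_apply,
      ContinuousLinearMap.comp_apply]
    refine ⟨fun ⟨h₁, h₂⟩ => by simpa [h₂] using h₁, fun h => by simp [h]⟩
  rw [this]

lemma range_ne_top_of_index_lt {T : E →L[𝕜] F}
    (h : T.toLinearMap.index < Module.finrank 𝕜 T.ker) : T.range ≠ ⊤ := by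
  intro h'
  rw [LinearMap.index_of_surjective (LinearMap.range_eq_top.1 h')] at h
  exact lt_irrefl _ h

/-- The dimension of the kernel of a Fredholm operator can be decreased, by a perturbation of finite
rank, to any number that the index admits. -/
lemma exists_equiv_finrank_ker_eq {T : E →L[𝕜] F} (hT : T.IsFredholm) {n : ℕ}
    (hn : n ≤ Module.finrank 𝕜 T.ker) (hi : T.toLinearMap.index ≤ n) :
    ∃ S : E →L[𝕜] F, S.toLinearMap ≈ T.toLinearMap ∧ Module.finrank 𝕜 S.ker = n := by
  induction h : Module.finrank 𝕜 T.ker - n generalizing T with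
  | zero => exact ⟨T, Setoid.refl _, by lia⟩
  | succ m ih =>
    obtain ⟨f, c, hfc⟩ := exists_add_smulRight_ker hT (by lia) (range_ne_top_of_index_lt (by lia))
    specialize hfc 1 one_ne_zero
    have he := add_smulRight_equiv T f ((1 : 𝕜) • c)
    obtain ⟨S, hS, hS'⟩ := ih (IsFredholm.of_equiv hT he) (by lia)
      (by rwa [IsFredholm.index_eq_of_equiv hT he]) (by lia)
    exact ⟨S, Setoid.trans hS he, hS'⟩

/-- Perturb to nullity zero; the index then makes the cokernel vanish too, and a bounded bijection
of Banach spaces is an isomorphism. -/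
lemma nonempty_equiv_of_index_eq_zero [CompleteSpace E] [CompleteSpace F] {T : E →L[𝕜] F}
    (hT : T.IsFredholm) (hi : T.toLinearMap.index = 0) : Nonempty (E ≃L[𝕜] F) := by
  obtain ⟨S, hS, hk⟩ := exists_equiv_finrank_ker_eq hT (Nat.zero_le _) (by simp [hi])
  have hF := IsFredholm.of_equiv hT hS
  have := hF.finite_ker
  have : FiniteDimensional 𝕜 (F ⧸ S.range) := hF.finite_coker
  have hker : S.ker = ⊥ := Submodule.finrank_eq_zero.1 hk
  have hi' := (LinearMap.index_eq_finrank_sub (f := S.toLinearMap)).symm.trans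
    ((IsFredholm.index_eq_of_equiv hT hS).trans hi)
  have hran : S.range = ⊤ := by
    rw [← Submodule.Quotient.subsingleton_iff]
    exact (Module.finrank_zero_iff (R := 𝕜)).1 (by lia)
  exact ⟨.ofBijective S hker hran⟩

end FredholmOperators

/-! ### Index and nullity classify Fredholm operators up to equivalence -/

section Equivalence

open LinearMap.FiniteRangeSetoid

variable {𝕜 : Type*} [RCLike 𝕜]
variable {E : Type*} [NormedAddCommGroup E] [NormedSpace 𝕜 E]
variable {F : Type*} [NormedAddCommGroup F] [NormedSpace 𝕜 F]

lemma isQuasiInverse_subtypeL_proj (d : FredholmDecomposition 𝕜 E) :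
    LinearMap.IsQuasiInverse d.X₁.subtypeL.toLinearMap d.proj.toLinearMap :=
  have := d.finite_X₀
  LinearMap.isQuasiInverse_subtype_projectionOnto d.isTopCompl.isCompl

lemma isFredholm_proj (d : FredholmDecomposition 𝕜 E) : d.proj.IsFredholm :=
  .of_isQuasiInverse (isQuasiInverse_subtypeL_proj d)

lemma isFredholm_subtypeL (d : FredholmDecomposition 𝕜 E) : d.X₁.subtypeL.IsFredholm :=
  .of_isQuasiInverse (isQuasiInverse_subtypeL_proj d).symm

lemma index_proj (d : FredholmDecomposition 𝕜 E) :
    d.proj.toLinearMap.index = Module.finrank 𝕜 d.X₀ := by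
  rw [LinearMap.index_of_surjective (Submodule.projectionOntoL_surjective d.isTopCompl),
    Submodule.ker_projectionOntoL]

lemma index_subtypeL (d : FredholmDecomposition 𝕜 E) :
    d.X₁.subtypeL.toLinearMap.index = -Module.finrank 𝕜 d.X₀ := by
  have h := IsFredholm.index_comp (isFredholm_proj d) (isFredholm_subtypeL d)
  have : (d.proj ∘L d.X₁.subtypeL).toLinearMap = LinearMap.id := by
    ext x
    simp
  rw [this, LinearMap.index_id, index_proj] at h
  lia

/-- Complements of finite-dimensional subspaces of the same dimension are isomorphic. -/
lemma nonempty_equiv_of_finrank_eq [CompleteSpace E] [CompleteSpace F] (e : E ≃L[𝕜] F)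
    (d : FredholmDecomposition 𝕜 E) (d' : FredholmDecomposition 𝕜 F)
    (h : Module.finrank 𝕜 d.X₀ = Module.finrank 𝕜 d'.X₀) : Nonempty (d.X₁ ≃L[𝕜] d'.X₁) := by
  have : CompleteSpace d.X₁ := d.isTopCompl.symm.isClosed'.completeSpace_coe
  have : CompleteSpace d'.X₁ := d'.isTopCompl.symm.isClosed'.completeSpace_coe
  have h₁ := IsFredholm.comp (isFredholm_equiv e) (isFredholm_subtypeL d)
  -- Include, apply `e`, project: the indices `-dim d.X₀`, `0` and `dim d'.X₀` cancel.
  refine nonempty_equiv_of_index_eq_zero (IsFredholm.comp (isFredholm_proj d') h₁) ?_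
  rw [IsFredholm.index_comp (isFredholm_proj d') h₁,
    IsFredholm.index_comp (isFredholm_equiv e) (isFredholm_subtypeL d), index_proj, index_subtypeL,
    index_equiv]
  lia

lemma finrank_X₀_eq_coker {T : E →L[𝕜] E} (p : T.FredholmPackage) :
    Module.finrank 𝕜 p.decCodom.X₀ = Module.finrank 𝕜 (E ⧸ T.range) := by
  rw [p.range_eq]
  exact (Submodule.quotientEquivOfIsTopCompl _ _ p.decCodom.isTopCompl).toLinearEquiv.finrank_eq.symm

/-- Fredholm operators on isomorphic spaces with the same index and nullity are equivalent. -/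
theorem exists_equiv_comp_eq [CompleteSpace E] [CompleteSpace F] (e : E ≃L[𝕜] F)
    {T : E →L[𝕜] E} {S : F →L[𝕜] F} (hT : T.IsFredholm) (hS : S.IsFredholm)
    (hi : T.toLinearMap.index = S.toLinearMap.index)
    (hk : Module.finrank 𝕜 T.ker = Module.finrank 𝕜 S.ker) :
    ∃ (P : F ≃L[𝕜] E) (Q : E ≃L[𝕜] F), T = (P : F →L[𝕜] E) ∘L S ∘L (Q : E →L[𝕜] F) := by
  obtain ⟨p⟩ := hT.nonempty_fredholmPackage
  obtain ⟨q⟩ := hS.nonempty_fredholmPackage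
  have hd : Module.finrank 𝕜 p.decDom.X₀ = Module.finrank 𝕜 q.decDom.X₀ := by
    rwa [← p.ker_eq, ← q.ker_eq]
  have hc : Module.finrank 𝕜 q.decCodom.X₀ = Module.finrank 𝕜 p.decCodom.X₀ := by
    rw [finrank_X₀_eq_coker, finrank_X₀_eq_coker, finrank_coker_eq hi hk]
  have := p.decDom.finite_X₀
  have := q.decDom.finite_X₀
  have := p.decCodom.finite_X₀
  have := q.decCodom.finite_X₀
  obtain ⟨j⟩ := nonempty_equiv_of_finrank_eq e p.decDom q.decDom hd
  -- `Q` matches kernels by any isomorphism and their complements by `j`. `P` must then carry `j`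
  -- over to the ranges; on the complements of the ranges it is arbitrary.
  let Q : E ≃L[𝕜] F :=
    (Submodule.prodEquivOfIsTopCompl _ _ p.decDom.isTopCompl).symm.trans
      ((j.prodCongr (.ofFinrankEq hd)).trans
        (Submodule.prodEquivOfIsTopCompl _ _ q.decDom.isTopCompl))
  let P : F ≃L[𝕜] E :=
    (Submodule.prodEquivOfIsTopCompl _ _ q.decCodom.isTopCompl).symm.trans
      (((q.equiv.symm.trans (j.symm.trans p.equiv)).prodCongr (.ofFinrankEq hc)).trans
        (Submodule.prodEquivOfIsTopCompl _ _ p.decCodom.isTopCompl))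
  have hQ (x : E) : q.decDom.proj (Q x) = j (p.decDom.proj x) := by
    simp [Q, Submodule.prodEquivOfIsTopCompl_apply, Submodule.prodEquivOfIsTopCompl_symm_apply]
  have hP (y : q.decCodom.X₁) : P y = p.equiv (j.symm (q.equiv.symm y)) := by
    simp [P, Submodule.prodEquivOfIsTopCompl_apply, Submodule.prodEquivOfIsTopCompl_symm_apply]
  refine ⟨P, Q, ?_⟩
  ext x
  have h₁ : T x = p.equiv (p.decDom.proj x) := congr($p.eq_equiv x)
  have h₂ : S (Q x) = q.equiv (q.decDom.proj (Q x)) := congr($q.eq_equiv (Q x))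
  change T x = P (S (Q x))
  rw [h₁, h₂, hP, hQ]
  simp

lemma isFredholm_prodMap_id {T : E →L[𝕜] E} (hT : T.IsFredholm) :
    (T.prodMap (ContinuousLinearMap.id 𝕜 F)).IsFredholm := by
  have key {A B : E →ₗ[𝕜] E} (h : A ∘ₗ B ≈ LinearMap.id) :
      A.prodMap (LinearMap.id (M := F)) ∘ₗ B.prodMap (LinearMap.id (M := F)) ≈ LinearMap.id := by
    rw [equiv_iff_hasFiniteRange] at h ⊢
    have : A.prodMap (LinearMap.id (M := F)) ∘ₗ B.prodMap LinearMap.id - LinearMap.id =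
        LinearMap.inl 𝕜 E F ∘ₗ (A ∘ₗ B - LinearMap.id) ∘ₗ LinearMap.fst 𝕜 E F := by
      ext <;> simp
    rw [this]
    exact (h.comp_right _).comp_left _
  obtain ⟨S, hS⟩ := hT.exists_isQuasiInverse
  exact .of_isQuasiInverse (v := S.prodMap (ContinuousLinearMap.id 𝕜 F)) ⟨key hS.1, key hS.2⟩

lemma finrank_ker_prodMap_id (T : E →L[𝕜] E) :
    Module.finrank 𝕜 (T.prodMap (ContinuousLinearMap.id 𝕜 F)).ker = Module.finrank 𝕜 T.ker := by
  have h : (T.prodMap (ContinuousLinearMap.id 𝕜 F)).ker = T.ker.map (LinearMap.inl 𝕜 E F) := by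
    ext ⟨x, y⟩
    simp [eq_comm]
  rw [h]
  exact (Submodule.equivMapOfInjective _ LinearMap.inl_injective _).finrank_eq.symm

lemma index_prodMap_id (T : E →L[𝕜] E) :
    (T.prodMap (ContinuousLinearMap.id 𝕜 F)).toLinearMap.index = T.toLinearMap.index := by
  have h : (T.prodMap (ContinuousLinearMap.id 𝕜 F)).range =
      (T.range.mkQ ∘ₗ LinearMap.fst 𝕜 E F).ker := by
    ext ⟨x, y⟩
    simp
  have e := (Submodule.quotEquivOfEq _ _ h).trans
    ((T.range.mkQ ∘ₗ LinearMap.fst 𝕜 E F).quotKerEquivOfSurjective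
      (T.range.mkQ_surjective.comp Prod.fst_surjective))
  have h₁ := LinearMap.index_eq_finrank_sub
    (f := (T.prodMap (ContinuousLinearMap.id 𝕜 F)).toLinearMap)
  rw [h₁, finrank_ker_prodMap_id, e.finrank_eq, LinearMap.index_eq_finrank_sub]

lemma finrank_ker_comp_equiv {G H : Type*} [NormedAddCommGroup G] [NormedSpace 𝕜 G]
    [NormedAddCommGroup H] [NormedSpace 𝕜 H] (P : F ≃L[𝕜] G) (S : E →L[𝕜] F) (Q : H ≃L[𝕜] E) :
    Module.finrank 𝕜 ((P : F →L[𝕜] G) ∘L S ∘L (Q : H →L[𝕜] E)).ker = Module.finrank 𝕜 S.ker := by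
  have h : S.ker = ((P : F →L[𝕜] G) ∘L S ∘L (Q : H →L[𝕜] E)).ker.map Q.toLinearMap := by
    ext x
    simp only [Submodule.mem_map, LinearMap.mem_ker]
    refine ⟨fun hx => ⟨Q.symm x, ?_, by simp⟩, ?_⟩
    · have : S x = 0 := hx
      simp [this]
    · rintro ⟨y, hy, rfl⟩
      simpa using hy
  rw [h]
  exact (Submodule.equivMapOfInjective _ Q.injective _).finrank_eq

end Equivalence

/-! ### Equivalence after extension means equal nullities -/

section ExtensionEquivalence

variable {𝕜 : Type*} [RCLike 𝕜]
variable {X : Type u} [NormedAddCommGroup X] [NormedSpace 𝕜 X]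
variable {Y : Type v} [NormedAddCommGroup Y] [NormedSpace 𝕜 Y]

lemma IsEAE.finrank_ker_eq {U : X →L[𝕜] X} {V : Y →L[𝕜] Y} (h : IsEAE U V) :
    Module.finrank 𝕜 U.ker = Module.finrank 𝕜 V.ker := by
  obtain ⟨X₀, _, _, _, Y₀, _, _, _, P, Q, h⟩ := h
  rw [← finrank_ker_prodMap_id (F := X₀), h, finrank_ker_comp_equiv, finrank_ker_prodMap_id]

/-- Fredholm operators with the same index and nullity are equivalent after extension. -/
theorem isEAE_of_finrank_ker_eq [CompleteSpace X] [CompleteSpace Y] {U : X →L[𝕜] X}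
    {V : Y →L[𝕜] Y} (hU : U.IsFredholm) (hV : V.IsFredholm)
    (hi : U.toLinearMap.index = V.toLinearMap.index)
    (hk : Module.finrank 𝕜 U.ker = Module.finrank 𝕜 V.ker) : IsEAE U V := by
  -- Extending each operator by a copy of the other space makes the two sums isomorphic by a swap;
  -- `ULift` only adjusts universes.
  let X₀ := ULift.{u} Y
  let Y₀ := ULift.{v} X
  have e : (X × X₀) ≃L[𝕜] (Y × Y₀) :=
    (ContinuousLinearEquiv.prodComm 𝕜 X X₀).trans
      (ContinuousLinearEquiv.ulift.prodCongr ContinuousLinearEquiv.ulift.symm)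
  have : CompleteSpace X₀ := ContinuousLinearEquiv.ulift (R₁ := 𝕜) (M₁ := Y)
    |>.isUniformEmbedding.isUniformInducing.completeSpace_congr
      (ContinuousLinearEquiv.surjective _) |>.2 inferInstance
  have : CompleteSpace Y₀ := ContinuousLinearEquiv.ulift (R₁ := 𝕜) (M₁ := X)
    |>.isUniformEmbedding.isUniformInducing.completeSpace_congr
      (ContinuousLinearEquiv.surjective _) |>.2 inferInstance
  obtain ⟨P, Q, h⟩ := exists_equiv_comp_eq e (isFredholm_prodMap_id (F := X₀) hU)
    (isFredholm_prodMap_id (F := Y₀) hV) (by simp only [index_prodMap_id, hi])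
    (by simp only [finrank_ker_prodMap_id, hk])
  exact ⟨X₀, _, _, inferInstance, Y₀, _, _, inferInstance, P, Q, h⟩

end ExtensionEquivalence

/-! ### Schur coupling and the nullities it realises -/

section SchurCoupling

open LinearMap.FiniteRangeSetoid

variable {𝕜 : Type*} [RCLike 𝕜]
variable {X : Type*} [NormedAddCommGroup X] [NormedSpace 𝕜 X]
variable {Y : Type*} [NormedAddCommGroup Y] [NormedSpace 𝕜 Y]

lemma IsSC.symm {U : X →L[𝕜] X} {V : Y →L[𝕜] Y} (h : IsSC U V) : IsSC V U := by
  obtain ⟨A, D, B, C, hU, hV⟩ := h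
  exact ⟨D, A, C, B, hV, hU⟩

/-- `D⁻¹ C` embeds `ker U` in `ker V`: there `A x = B D⁻¹ C x`, so `D⁻¹ C x = 0` forces `x = 0`. -/
lemma IsSC.finrank_ker_le {U : X →L[𝕜] X} {V : Y →L[𝕜] Y} (h : IsSC U V)
    [FiniteDimensional 𝕜 V.ker] : Module.finrank 𝕜 U.ker ≤ Module.finrank 𝕜 V.ker := by
  obtain ⟨A, D, B, C, rfl, rfl⟩ := h
  have key (x : X) (hx : x ∈ ((A : X →L[𝕜] X) - B ∘L (D.symm : Y →L[𝕜] Y) ∘L C).ker) :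
      A x = B (D.symm (C x)) := sub_eq_zero.1 hx
  let g := ((D.symm : Y →L[𝕜] Y) ∘L C).toLinearMap.restrict
    (p := ((A : X →L[𝕜] X) - B ∘L (D.symm : Y →L[𝕜] Y) ∘L C).ker)
    (q := ((D : Y →L[𝕜] Y) - C ∘L (A.symm : X →L[𝕜] X) ∘L B).ker)
    (fun x hx => by simp [← key x hx])
  refine LinearMap.finrank_le_finrank_of_injective (f := g) ?_
  rw [injective_iff_map_eq_zero]
  rintro ⟨x, hx⟩ h
  have h' : D.symm (C x) = 0 := congr(($h : Y))
  have := key x hx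
  rw [h', map_zero] at this
  exact Subtype.ext (by simpa using this)

lemma IsSC.finrank_ker_eq {U : X →L[𝕜] X} {V : Y →L[𝕜] Y} (h : IsSC U V)
    (hU : U.IsFredholm) (hV : V.IsFredholm) :
    Module.finrank 𝕜 U.ker = Module.finrank 𝕜 V.ker :=
  have := hU.finite_ker
  have := hV.finite_ker
  le_antisymm h.finrank_ker_le h.symm.finrank_ker_le

lemma IsSC.comp_equiv {U : X →L[𝕜] X} {V : Y →L[𝕜] Y} (h : IsSC U V) (P Q : X ≃L[𝕜] X)
    (P' Q' : Y ≃L[𝕜] Y) :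
    IsSC ((P : X →L[𝕜] X) ∘L U ∘L (Q : X →L[𝕜] X))
      ((P' : Y →L[𝕜] Y) ∘L V ∘L (Q' : Y →L[𝕜] Y)) := by
  obtain ⟨A, D, B, C, rfl, rfl⟩ := h
  refine ⟨Q.trans (A.trans P), Q'.trans (D.trans P'), (P : X →L[𝕜] X) ∘L B ∘L (Q' : Y →L[𝕜] Y),
    (P' : Y →L[𝕜] Y) ∘L C ∘L (Q : X →L[𝕜] X), ?_, ?_⟩ <;> ext x <;> simp

/-- Schur coupling of Fredholm operators of a given index depends only on the nullities. -/
lemma IsSC.of_finrank_ker_eq [CompleteSpace X] [CompleteSpace Y] {k : ℤ} {U U' : X →L[𝕜] X}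
    {V V' : Y →L[𝕜] Y} (h : IsSC U V) (hU : U ∈ Phi 𝕜 X k) (hV : V ∈ Phi 𝕜 Y k)
    (hU' : U' ∈ Phi 𝕜 X k) (hV' : V' ∈ Phi 𝕜 Y k)
    (hX : Module.finrank 𝕜 U'.ker = Module.finrank 𝕜 U.ker)
    (hY : Module.finrank 𝕜 V'.ker = Module.finrank 𝕜 V.ker) : IsSC U' V' := by
  obtain ⟨P, Q, rfl⟩ := exists_equiv_comp_eq (.refl 𝕜 X) hU'.1 hU.1 (hU'.2.trans hU.2.symm) hX
  obtain ⟨P', Q', rfl⟩ := exists_equiv_comp_eq (.refl 𝕜 Y) hV'.1 hV.1 (hV'.2.trans hV.2.symm) hY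
  exact h.comp_equiv P Q P' Q'

lemma mem_Phi_of_equiv {k : ℤ} {U U' : X →L[𝕜] X} (hU : U ∈ Phi 𝕜 X k)
    (h : U'.toLinearMap ≈ U.toLinearMap) : U' ∈ Phi 𝕜 X k :=
  ⟨IsFredholm.of_equiv hU.1 h, (IsFredholm.index_eq_of_equiv hU.1 h).trans hU.2⟩

lemma mem_Phi_zero_of_equiv_id {U : X →L[𝕜] X} (h : U.toLinearMap ≈ LinearMap.id) :
    U ∈ Phi 𝕜 X 0 :=
  mem_Phi_of_equiv (U := ContinuousLinearMap.id 𝕜 X)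
    ⟨isFredholm_equiv (.refl 𝕜 X), index_equiv (.refl 𝕜 X)⟩ h

/-- A rank-one perturbation of an isomorphism `A` by `c ⊗ f` is an isomorphism if
`f (A⁻¹ c) ≠ -1`. -/
lemma exists_equiv_add_smulRight (A : X ≃L[𝕜] X) (f : X →L[𝕜] 𝕜) (c : X)
    (h : 1 + f (A.symm c) ≠ 0) :
    ∃ A' : X ≃L[𝕜] X, (A' : X →L[𝕜] X) = A + f.smulRight c ∧
      (A'.symm : X →L[𝕜] X) = A.symm -
        (f ∘L (A.symm : X →L[𝕜] X)).smulRight ((1 + f (A.symm c))⁻¹ • A.symm c) := by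
  -- The inverse is given by the Sherman–Morrison formula.
  refine ⟨.equivOfInverse (A + f.smulRight c) (A.symm -
    (f ∘L (A.symm : X →L[𝕜] X)).smulRight ((1 + f (A.symm c))⁻¹ • A.symm c)) (fun x => ?_)
    (fun x => ?_), rfl, rfl⟩
  · simp only [sub_apply, add_apply, ContinuousLinearMap.smulRight_apply,
      ContinuousLinearMap.comp_apply, ContinuousLinearEquiv.coe_coe, map_add, map_smul,
      ContinuousLinearEquiv.symm_apply_apply]
    match_scalars <;> field_simp <;> ring
  · simp only [sub_apply, add_apply, ContinuousLinearMap.smulRight_apply,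
      ContinuousLinearMap.comp_apply, ContinuousLinearEquiv.coe_coe, map_sub, map_smul,
      ContinuousLinearEquiv.apply_symm_apply]
    match_scalars <;> field_simp <;> ring

/-- A rank-one perturbation of `U = A - B D⁻¹ C` that keeps `A` invertible preserves Schur coupling
to some Fredholm operator of the same index. -/
lemma exists_isSC_add_smulRight {k : ℤ} {A : X ≃L[𝕜] X} {D : Y ≃L[𝕜] Y} {B : Y →L[𝕜] X}
    {C : X →L[𝕜] Y} (hV : (D : Y →L[𝕜] Y) - C ∘L (A.symm : X →L[𝕜] X) ∘L B ∈ Phi 𝕜 Y k)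
    (f : X →L[𝕜] 𝕜) (c : X) (h : 1 + f (A.symm c) ≠ 0) :
    ∃ V' ∈ Phi 𝕜 Y k,
      IsSC ((A : X →L[𝕜] X) - B ∘L (D.symm : Y →L[𝕜] Y) ∘L C + f.smulRight c) V' := by
  obtain ⟨A', hA', hA's⟩ := exists_equiv_add_smulRight A f c h
  -- Only `A` changes. Its inverse changes by rank at most one, hence so does `D - C A⁻¹ B`.
  refine ⟨_, mem_Phi_of_equiv hV ?_, A', D, B, C, ?_, rfl⟩
  · apply equiv_of_sub_hasFiniteRange
    rw [hA's]
    set r := (1 + f (A.symm c))⁻¹ • A.symm c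
    have : (D : Y →L[𝕜] Y) - C ∘L ((A.symm : X →L[𝕜] X) -
        (f ∘L (A.symm : X →L[𝕜] X)).smulRight r) ∘L B -
          ((D : Y →L[𝕜] Y) - C ∘L (A.symm : X →L[𝕜] X) ∘L B) =
        (f ∘L (A.symm : X →L[𝕜] X) ∘L B).smulRight (C r) := by
      ext y
      simp
    rw [this]
    exact hasFiniteRange_smulRight _ _
  · rw [hA']
    abel

variable (𝕜 X Y) in
/-- The nullities of the first components of the Schur coupled pairs of Fredholm operators of
index `k`. -/
def scNullities (k : ℤ) : Set ℕ :=
  {n | ∃ p ∈ SC 𝕜 X Y k, Module.finrank 𝕜 p.1.ker = n}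

lemma mem_scNullities_of_succ {k : ℤ} {n : ℕ} (hn : n + 1 ∈ scNullities 𝕜 X Y k) (hk : k ≤ n) :
    n ∈ scNullities 𝕜 X Y k := by
  obtain ⟨⟨_, _⟩, ⟨hU, hV, A, D, B, C, rfl, rfl⟩, hn⟩ := hn
  simp only at hU hV hn
  obtain ⟨f, c, hfc⟩ := exists_add_smulRight_ker hU.1 (by lia)
    (range_ne_top_of_index_lt (by rw [hU.2, hn]; lia))
  -- Only one value of `t` can be bad; if it is `1`, then `2` works.
  obtain ⟨t, ht, h⟩ : ∃ t : 𝕜, t ≠ 0 ∧ 1 + f (A.symm (t • c)) ≠ 0 := by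
    by_cases h : 1 + f (A.symm c) = 0
    · refine ⟨2, two_ne_zero, ?_⟩
      have : f (A.symm c) = -1 := eq_neg_of_add_eq_zero_right h
      simp only [map_smul, this, smul_eq_mul]
      norm_num
    · exact ⟨1, one_ne_zero, by simpa using h⟩
  obtain ⟨V', hV', hSC⟩ := exists_isSC_add_smulRight hV f (t • c) h
  refine ⟨(_, V'), ⟨mem_Phi_of_equiv hU (add_smulRight_equiv _ f (t • c)), hV', hSC⟩, ?_⟩
  have := hfc t ht
  simp only
  lia

/-- Perturb by `f = g ∘ U` and `c = -U x` with `g (U x) = 1`. With `W = I - A⁻¹ U`, the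
invertibility condition on `A` becomes `g (U (W x)) ≠ 0`, so it suffices that `U x` and `U (W x)`
are both nonzero for some `x`. -/
lemma succ_mem_scNullities {k : ℤ} {n : ℕ} (hn : n ∈ scNullities 𝕜 X Y k) (hk : k ≠ 0) :
    n + 1 ∈ scNullities 𝕜 X Y k := by
  obtain ⟨⟨_, _⟩, ⟨hU, hV, A, D, B, C, rfl, rfl⟩, hn⟩ := hn
  simp only at hU hV hn
  set U := (A : X →L[𝕜] X) - B ∘L (D.symm : Y →L[𝕜] Y) ∘L C
  have := hU.1.finite_ker
  let W : X →L[𝕜] X := (A.symm : X →L[𝕜] X) ∘L (A - U)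
  have hW (x : X) : W x = x - A.symm (U x) := by simp [W]
  obtain ⟨x, hx, hWx⟩ : ∃ x, U x ≠ 0 ∧ U (W x) ≠ 0 := by
    by_contra! hcon
    -- Otherwise `U W` vanishes off `ker U`, hence everywhere by translating with some `x₀` outside
    -- it. Then `W` has finite rank and `U` has the index of `A`, which is zero.
    have hrange : W.range ≤ U.ker := by
      rintro _ ⟨x, rfl⟩
      change U (W x) = 0
      by_cases hx : U x = 0
      · by_cases hx₀ : ∃ x₀, U x₀ ≠ 0
        · obtain ⟨x₀, hx₀⟩ := hx₀
          have h₁ := hcon (x + x₀) (by simpa [hx])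
          rwa [map_add, map_add, hcon x₀ hx₀, add_zero] at h₁
        · push Not at hx₀
          exact hx₀ _
      · exact hcon x hx
    have hfin : FiniteDimensional 𝕜 W.range := Submodule.finiteDimensional_of_le hrange
    have hequiv : U.toLinearMap ≈ (A : X →L[𝕜] X).toLinearMap := by
      apply equiv_of_sub_hasFiniteRange
      have : U - (A : X →L[𝕜] X) = (-(A : X →L[𝕜] X)) ∘L W := by
        ext x
        simp only [W, sub_apply, ContinuousLinearMap.comp_apply, neg_apply,
          ContinuousLinearEquiv.coe_coe, ContinuousLinearEquiv.apply_symm_apply, neg_sub]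
      rw [this]
      exact LinearMap.HasFiniteRange.comp_left (Module.Finite.iff_fg.1 hfin) _
    exact hk (hU.2.symm.trans
      ((IsFredholm.index_eq_of_equiv (isFredholm_equiv A) hequiv).trans (index_equiv A)))
  obtain ⟨g, hg₁, hg₂⟩ := SeparatingDual.exists_eq_one_ne_zero_of_ne_zero_pair (R := 𝕜) hx hWx
  have h : 1 + (g ∘L U) (A.symm (-U x)) ≠ 0 := by
    rw [hW, map_sub, map_sub, hg₁] at hg₂
    rw [map_neg, map_neg, ← sub_eq_add_neg]
    exact hg₂
  obtain ⟨V', hV', hSC⟩ := exists_isSC_add_smulRight hV (g ∘L U) (-U x) h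
  refine ⟨(_, V'), ⟨mem_Phi_of_equiv hU (add_smulRight_equiv _ (g ∘L U) (-U x)), hV', hSC⟩, ?_⟩
  exact (finrank_ker_sub_smulRight hU.1 hg₁).trans (by rw [hn])

lemma mem_scNullities_of_le {k : ℤ} {m n : ℕ} (hm : m ∈ scNullities 𝕜 X Y k) (hn : n ≤ m)
    (hk : k ≤ n) : n ∈ scNullities 𝕜 X Y k := by
  induction m, hn using Nat.le_induction with
  | base => exact hm
  | succ m hnm ih => exact ih (mem_scNullities_of_succ hm (by lia))

lemma mem_scNullities_of_ge {k : ℤ} {m n : ℕ} (hm : m ∈ scNullities 𝕜 X Y k) (hn : m ≤ n)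
    (hk : k ≠ 0) : n ∈ scNullities 𝕜 X Y k := by
  induction n, hn using Nat.le_induction with
  | base => exact hm
  | succ n hmn ih => exact succ_mem_scNullities ih hk

lemma id_sub_projection_mem_Phi (K : Submodule 𝕜 X) [FiniteDimensional 𝕜 K] (p : X →L[𝕜] K) :
    ContinuousLinearMap.id 𝕜 X - K.subtypeL ∘L p ∈ Phi 𝕜 X 0 := by
  refine mem_Phi_zero_of_equiv_id ?_
  refine equiv_of_sub_hasFiniteRange (T := ContinuousLinearMap.id 𝕜 X) ?_
  rw [sub_sub_cancel_left]
  exact (LinearMap.HasFiniteRange.comp_right (v := K.subtype) .of_finite_dom _).neg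

lemma ker_id_sub_projection (K : Submodule 𝕜 X) (p : X →L[𝕜] K) (hp : ∀ x : K, p x = x) :
    (ContinuousLinearMap.id 𝕜 X - K.subtypeL ∘L p).ker = K := by
  ext x
  simp only [LinearMap.mem_ker, ContinuousLinearMap.coe_coe, sub_apply,
    ContinuousLinearMap.comp_apply, ContinuousLinearMap.id_apply, sub_eq_zero]
  exact ⟨fun h => h ▸ (p x).2, fun h => congr(($(hp ⟨x, h⟩) : X)).symm⟩

/-- For index zero, projections onto finite-dimensional subspaces of the same dimension provide
Schur coupled pairs of any common nullity. -/
lemma isSC_of_index_zero [CompleteSpace X] [CompleteSpace Y] {U : X →L[𝕜] X} {V : Y →L[𝕜] Y}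
    (hU : U ∈ Phi 𝕜 X 0) (hV : V ∈ Phi 𝕜 Y 0)
    (hk : Module.finrank 𝕜 U.ker = Module.finrank 𝕜 V.ker) : IsSC U V := by
  obtain ⟨p, hp⟩ := hU.1.closedComplemented_ker
  obtain ⟨q, hq⟩ := hV.1.closedComplemented_ker
  have := hU.1.finite_ker
  have := hV.1.finite_ker
  let φ : U.ker ≃L[𝕜] V.ker := .ofFinrankEq hk
  -- `B` and `C` are mutually inverse between the kernels and factor through the projections `q` and
  -- `p`. So with `A = I` and `D = I` they couple the complementary projections.
  let C : X →L[𝕜] Y := V.ker.subtypeL ∘L (φ : U.ker →L[𝕜] V.ker) ∘L p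
  let B : Y →L[𝕜] X := U.ker.subtypeL ∘L (φ.symm : V.ker →L[𝕜] U.ker) ∘L q
  have hBC : B ∘L C = U.ker.subtypeL ∘L p := by ext x; simp [B, C, hq]
  have hCB : C ∘L B = V.ker.subtypeL ∘L q := by ext x; simp [B, C, hp]
  have hSC : IsSC (ContinuousLinearMap.id 𝕜 X - U.ker.subtypeL ∘L p)
      (ContinuousLinearMap.id 𝕜 Y - V.ker.subtypeL ∘L q) :=
    ⟨.refl 𝕜 X, .refl 𝕜 Y, B, C, by rw [← hBC]; rfl, by rw [← hCB]; rfl⟩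
  exact hSC.of_finrank_ker_eq (id_sub_projection_mem_Phi _ p) (id_sub_projection_mem_Phi _ q) hU hV
    (by rw [ker_id_sub_projection _ p hp]) (by rw [ker_id_sub_projection _ q hq])

/-- If some pair of Fredholm operators of index `k` is Schur coupled, then so is every such pair
with equal nullities. -/
theorem isSC_of_nonempty [CompleteSpace X] [CompleteSpace Y] {k : ℤ} (h : (SC 𝕜 X Y k).Nonempty)
    {U : X →L[𝕜] X} {V : Y →L[𝕜] Y} (hU : U ∈ Phi 𝕜 X k) (hV : V ∈ Phi 𝕜 Y k)
    (hk : Module.finrank 𝕜 U.ker = Module.finrank 𝕜 V.ker) : IsSC U V := by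
  -- Raising the nullity needs `k ≠ 0`, so index zero is treated directly.
  obtain rfl | hk₀ := eq_or_ne k 0
  · exact isSC_of_index_zero hU hV hk
  have hle : k ≤ Module.finrank 𝕜 U.ker := by
    have := hU.2
    rw [LinearMap.index_eq_finrank_sub] at this
    lia
  obtain ⟨p, hp⟩ := h
  have hp' : Module.finrank 𝕜 p.1.ker ∈ scNullities 𝕜 X Y k := ⟨p, hp, rfl⟩
  obtain ⟨⟨U', V'⟩, ⟨hU', hV', hSC⟩, hn⟩ : Module.finrank 𝕜 U.ker ∈ scNullities 𝕜 X Y k := by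
    obtain h | h := le_total (Module.finrank 𝕜 U.ker) (Module.finrank 𝕜 p.1.ker)
    · exact mem_scNullities_of_le hp' h hle
    · exact mem_scNullities_of_ge hp' h hk₀
  exact hSC.of_finrank_ker_eq hU' hV' hU hV hn.symm
    (by rw [← hk, ← hn]; exact hSC.finrank_ker_eq hU'.1 hV'.1)

end SchurCoupling

/-! ### The group of indices and its generator -/

section IndexSet

open LinearMap.FiniteRangeSetoid

variable (𝕜 : Type*) [RCLike 𝕜]
variable (X : Type*) [NormedAddCommGroup X] [NormedSpace 𝕜 X]

lemma Phi_comp_mem {k l : ℤ} {U V : X →L[𝕜] X} (hU : U ∈ Phi 𝕜 X k) (hV : V ∈ Phi 𝕜 X l) :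
    U ∘L V ∈ Phi 𝕜 X (k + l) :=
  ⟨IsFredholm.comp hU.1 hV.1, by rw [IsFredholm.index_comp hU.1 hV.1, hU.2, hV.2]⟩

/-- A quasi-inverse composed with `U` is a finite-rank perturbation of the identity, so the two
indices add up to zero. -/
lemma neg_mem_indexSet {k : ℤ} (hk : k ∈ indexSet 𝕜 X) : -k ∈ indexSet 𝕜 X := by
  obtain ⟨U, hU, rfl⟩ := hk
  obtain ⟨V, hV⟩ := hU.exists_isQuasiInverse
  have hV' : V.IsFredholm := .of_isQuasiInverse hV.symm
  refine ⟨V, hV', ?_⟩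
  have h := (mem_Phi_zero_of_equiv_id (U := V ∘L U) hV.1).2
  rw [IsFredholm.index_comp hV' hU] at h
  lia

/-- The indices of the Fredholm operators on a space form a group. -/
def indexSubgroup : AddSubgroup ℤ where
  carrier := indexSet 𝕜 X
  add_mem' := fun ⟨_, hU⟩ ⟨_, hV⟩ => ⟨_, Phi_comp_mem 𝕜 X hU hV⟩
  zero_mem' := ⟨_, mem_Phi_zero_of_equiv_id (U := ContinuousLinearMap.id 𝕜 X) (Setoid.refl _)⟩
  neg_mem' := neg_mem_indexSet 𝕜 X

variable (Y : Type*) [NormedAddCommGroup Y] [NormedSpace 𝕜 Y]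

/-- The common indices form a subgroup of `ℤ`, generated by its least positive element through
division with remainder. The default value `0` fits: without positive elements the subgroup is
trivial. -/
lemma eae_dvd_iff (k : ℤ) : (eae 𝕜 X Y : ℤ) ∣ k ↔ k ∈ indexSet 𝕜 X ∩ indexSet 𝕜 Y := by
  classical
  let H := indexSubgroup 𝕜 X ⊓ indexSubgroup 𝕜 Y
  change _ ↔ k ∈ H
  have habs {k : ℤ} (hk : k ∈ H) : (k.natAbs : ℤ) ∈ H := by
    obtain h | h := Int.natAbs_eq k
    · rwa [← h]
    · rw [h] at hk
      simpa using H.neg_mem hk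
  unfold eae
  split_ifs with h
  · obtain ⟨hpos, hmem⟩ := Nat.find_spec h
    have hmem : (Nat.find h : ℤ) ∈ H := hmem
    refine ⟨fun ⟨m, hm⟩ => ?_, fun hk => ?_⟩
    · rw [hm, mul_comm, ← smul_eq_mul]
      exact H.zsmul_mem hmem m
    · have hmod : k % (Nat.find h : ℤ) ∈ H := by
        rw [Int.emod_def, mul_comm, ← smul_eq_mul]
        exact H.sub_mem hk (H.zsmul_mem hmem _)
      have h₀ := Int.emod_nonneg k (b := Nat.find h) (by lia)
      have h₁ := Int.emod_lt_of_pos k (b := Nat.find h) (by lia)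
      rw [Int.dvd_iff_emod_eq_zero]
      by_contra hne
      exact Nat.find_min h (m := (k % (Nat.find h : ℤ)).natAbs) (by lia) ⟨by lia, habs hmod⟩
  · rw [Nat.cast_zero, zero_dvd_iff]
    refine ⟨fun hk => hk ▸ H.zero_mem, fun hk => ?_⟩
    by_contra hne
    exact h ⟨k.natAbs, by lia, habs hk⟩

variable {𝕜 X}

/-- The value `k.toNat` is the least nullity that index `k` permits. It does not depend on the
space, so choices made on `X` and `Y` have equal nullities. -/
lemma exists_mem_Phi_finrank_ker {k : ℤ} (hk : k ∈ indexSet 𝕜 X) :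
    ∃ U ∈ Phi 𝕜 X k, Module.finrank 𝕜 U.ker = k.toNat := by
  obtain ⟨U, hU⟩ := hk
  have h := hU.2
  rw [LinearMap.index_eq_finrank_sub] at h
  obtain ⟨S, hS, hS'⟩ := exists_equiv_finrank_ker_eq hU.1 (n := k.toNat) (by lia)
    (by rw [hU.2]; lia)
  exact ⟨S, mem_Phi_of_equiv hU hS, hS'⟩

end IndexSet

end FredholmCoupling

theorem theorem1p4 {𝕜 : Type*} [RCLike 𝕜]
    {X : Type*} [NormedAddCommGroup X] [NormedSpace 𝕜 X] [CompleteSpace X]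
    {Y : Type*} [NormedAddCommGroup Y] [NormedSpace 𝕜 Y] [CompleteSpace Y] (k : ℤ) :
    ((EAE 𝕜 X Y k).Nonempty ↔ (eae 𝕜 X Y : ℤ) ∣ k) ∧
    ((eae 𝕜 X Y : ℤ) ∣ k → (SC 𝕜 X Y k = EAE 𝕜 X Y k ↔ (SC 𝕜 X Y k).Nonempty)) ∧
    (¬ (eae 𝕜 X Y : ℤ) ∣ k →
      (Phi 𝕜 X k = ∅ ∨ Phi 𝕜 Y k = ∅) ∧ SC 𝕜 X Y k = ∅ ∧ EAE 𝕜 X Y k = ∅) := by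
  have hEAE : (EAE 𝕜 X Y k).Nonempty ↔ (eae 𝕜 X Y : ℤ) ∣ k := by
    rw [eae_dvd_iff]
    refine ⟨fun ⟨p, hU, hV, _⟩ => ⟨⟨_, hU⟩, ⟨_, hV⟩⟩, fun ⟨hX, hY⟩ => ?_⟩
    obtain ⟨U, hU, hU'⟩ := exists_mem_Phi_finrank_ker hX
    obtain ⟨V, hV, hV'⟩ := exists_mem_Phi_finrank_ker hY
    exact ⟨(U, V), hU, hV, isEAE_of_finrank_ker_eq hU.1 hV.1 (hU.2.trans hV.2.symm)
      (hU'.trans hV'.symm)⟩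
  refine ⟨hEAE, fun hk => ⟨fun h => h ▸ hEAE.2 hk, fun h => ?_⟩, fun hk => ?_⟩
  -- SC always implies EAE here, through the nullities; only the converse uses the given SC pair.
  · ext ⟨U, V⟩
    exact ⟨fun ⟨hU, hV, hUV⟩ => ⟨hU, hV, isEAE_of_finrank_ker_eq hU.1 hV.1
        (hU.2.trans hV.2.symm) (hUV.finrank_ker_eq hU.1 hV.1)⟩,
      fun ⟨hU, hV, hUV⟩ => ⟨hU, hV, isSC_of_nonempty h hU hV hUV.finrank_ker_eq⟩⟩
  · have hΦ : Phi 𝕜 X k = ∅ ∨ Phi 𝕜 Y k = ∅ := by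
      rw [eae_dvd_iff] at hk
      by_contra! h
      exact hk h
    refine ⟨hΦ, ?_, ?_⟩ <;>
    · rw [Set.eq_empty_iff_forall_notMem]
      rintro p ⟨hU, hV, -⟩
      obtain h | h := hΦ
      · rwa [h] at hU
      · rwa [h] at hV
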